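/- Let $m,L\ge 1$ and let $\mathcal C=\{A_i\}_{1\le i\le L}$ be a family of symmetric matrices in $\mathbb R^{m\times m}$. Let $S$ be a nonsingular matrix in the linear span of $\mathcal C$, and suppose that the following three conditions hold. (1) For every $1\le i\le L$, the matrix $S^{-1}A_i$ has only real eigenvalues. (2) For all $1\le i\ne j\le L$, the $S$-commutator $[A_i,A_j]_S := S^{-1}A_iS^{-1}A_j-S^{-1}A_jS^{-1}A_i$ is zero. (3) There is an index $i$ such that the Jordan normal form of $S^{-1}A_i$ does not contain two Jordan blocks with the same eigenvalue and the same size. Then $\mathcal C$ is TWSD-B (bounded transformation based weakly simultaneously diagonalizable): there exist matrices $P_k\in\mathbb R^{m\times m}$ with $\det P_k=1$ and real diagonal matrices $D_k^{(i)}\in\mathbb R^{m\times m}$ ($k\ge 1$, $1\le i\le L$), with $\|D_k^{(i)}\|$ bounded uniformly in $k$ and $i$, such that $$\lim_{k\to\infty}\ \sum_{i=1}^{L}\bigl\|P_kA_iP_k^{\top}-D_k^{(i)}\bigr\|^2=0,$$ where $\|\cdot\|$ is the Frobenius norm. -/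

import Mathlib

noncomputable section

/-! ### The transformation based error measure and bounded weak simultaneous diagonalization -/

section FrobeniusNorm

open scoped Matrix.Norms.Frobenius

/-- `φ_T(P, 𝒟) = ∑ i, ‖P A_i Pᵀ - D_i‖²` (Frobenius norm) for a family `A` of `m × m` matrices,
an `n × m` matrix `P` and a family `D` of `n × n` matrices. -/
def phiT {m n L : ℕ} (A : Fin L → Matrix (Fin m) (Fin m) ℝ)
    (P : Matrix (Fin n) (Fin m) ℝ) (D : Fin L → Matrix (Fin n) (Fin n) ℝ) : ℝ :=
  ∑ i, ‖P * A i * P.transpose - D i‖ ^ 2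

/-- The family `A` is bounded transformation based weakly simultaneously diagonalizable: there are
`P_k ∈ SL_m(ℝ)` and families of diagonal matrices `D_k`, uniformly bounded in norm, such that
`φ_T(P_k, D_k) → 0`. -/
def IsTWSDB {m L : ℕ} (A : Fin L → Matrix (Fin m) (Fin m) ℝ) : Prop :=
  ∃ (P : ℕ → Matrix.SpecialLinearGroup (Fin m) ℝ)
    (D : ℕ → Fin L → Matrix (Fin m) (Fin m) ℝ),
    (∀ k i, (D k i).IsDiag) ∧
    Filter.Tendsto (fun k => phiT A (P k : Matrix (Fin m) (Fin m) ℝ) (D k))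
      Filter.atTop (nhds 0) ∧
    ∃ C : ℝ, ∀ k i, ‖D k i‖ ≤ C

end FrobeniusNorm

/-- The `S`-commutator `[A, B]_S = S⁻¹ A S⁻¹ B - S⁻¹ B S⁻¹ A` (for nonsingular `S`). -/
def sCommutator {m : ℕ} (S A B : Matrix (Fin m) (Fin m) ℝ) : Matrix (Fin m) (Fin m) ℝ :=
  S⁻¹ * A * S⁻¹ * B - S⁻¹ * B * S⁻¹ * A

/-- All complex eigenvalues of the real matrix `M` are real. -/
def HasOnlyRealEigenvalues {m : ℕ} (M : Matrix (Fin m) (Fin m) ℝ) : Prop :=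
  ∀ z : ℂ, Module.End.HasEigenvalue (Matrix.toLin' (M.map (algebraMap ℝ ℂ))) z → z.im = 0

/-! ### Real Jordan normal form -/

/-- The data (eigenvalue and size) of a real Jordan block: either a real eigenvalue `lam` and the
number `d` of diagonal entries, or a pair `a ± b i` of non-real eigenvalues and the number `d` of
`2 × 2` diagonal cells. -/
inductive RealJordanBlock : Type
  | real (lam : ℝ) (d : ℕ) : RealJordanBlock
  | cplx (a b : ℝ) (d : ℕ) : RealJordanBlock

namespace RealJordanBlock

/-- Blocks are nonempty, and a pair `a ± b i` of non-real eigenvalues is listed with `b > 0`, so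
that two valid blocks are equal exactly if they have the same eigenvalue (pair) and size. -/
def Valid : RealJordanBlock → Prop
  | real _ d => 1 ≤ d
  | cplx _ b d => 0 < b ∧ 1 ≤ d

/-- The row and column index type of a block. -/
abbrev Index : RealJordanBlock → Type
  | real _ d => Fin d
  | cplx _ _ d => Fin d × Fin 2

/-- The block itself: `lam` on the diagonal and `1` on the superdiagonal, respectively the cells
`[a, -b; b, a]` on the block diagonal and `I₂` on the block superdiagonal. -/
def toMatrix : (B : RealJordanBlock) → Matrix B.Index B.Index ℝ
  | real lam d => fun i j : Fin d =>
      if i = j then lam else if i.val + 1 = j.val then 1 else 0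
  | cplx a b d => fun i j : Fin d × Fin 2 =>
      if i.1 = j.1 then !![a, -b; b, a] i.2 j.2
      else if i.1.val + 1 = j.1.val then (1 : Matrix (Fin 2) (Fin 2) ℝ) i.2 j.2
      else 0

end RealJordanBlock

/-- `Diag(B 0, …, B (r-1))` is the real Jordan normal form of `M`: the blocks are valid and `M` is
similar over `ℝ` to the block diagonal matrix built from them (the rows and columns of which are
enumerated by some bijection `e`). -/
def IsRealJordanNormalForm {m r : ℕ} (M : Matrix (Fin m) (Fin m) ℝ)
    (B : Fin r → RealJordanBlock) : Prop :=
  (∀ k, (B k).Valid) ∧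
  ∃ (e : (Σ k, (B k).Index) ≃ Fin m) (Q : Matrix (Fin m) (Fin m) ℝ),
    IsUnit Q.det ∧
    Q⁻¹ * M * Q =
      Matrix.reindex e e (Matrix.blockDiagonal' fun k => (B k).toMatrix)

/-- The real Jordan normal form of `M` does not contain two blocks with the same eigenvalue and
the same size. -/
def HasDistinctJordanBlocks {m : ℕ} (M : Matrix (Fin m) (Fin m) ℝ) : Prop :=
  ∃ (r : ℕ) (B : Fin r → RealJordanBlock),
    IsRealJordanNormalForm M B ∧ ∀ k l, k ≠ l → B k ≠ B l

end

/-! Write `J = Q⁻¹ (S⁻¹ A i₀) Q` for the Jordan form with distinct blocks, which are real because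
the eigenvalues are. `S` is symmetric, so commutation turns into `G J = Jᵀ G` for every `G = Qᵀ A i
Q`. Such a `G` vanishes between different eigenvalues; its other blocks are Hankel and vanish before
a certain antidiagonal (`entry_eq_zero`). Scaling by powers of `t → 0` with weights centred on each
block kills all that remains except the main antidiagonals of the diagonal blocks
(`exists_tendsto_scaling`). The limits are multiples of exchange matrices on each block,
diagonalized by one congruence for all `i` (`exists_diagonalize_blocks`). -/

noncomputable section

open Filter Topology

/-! ### Reduction to limits of congruences with constant determinant. -/

section FrobeniusNorm

open scoped Matrix.Norms.Frobenius

lemma frobenius_norm_sq {m n : ℕ} (M : Matrix (Fin m) (Fin n) ℝ) :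
    ‖M‖ ^ 2 = ∑ i, ∑ j, M i j ^ 2 := by
  rw [Matrix.frobenius_norm_def, ← Real.sqrt_eq_rpow, Real.sq_sqrt (by positivity)]
  simp

/-- It suffices to find congruences of constant nonzero determinant under which the family
converges entrywise to diagonal matrices. -/
lemma isTWSDB_of_tendsto {m L : ℕ} (A : Fin L → Matrix (Fin m) (Fin m) ℝ)
    (P : ℕ → Matrix (Fin m) (Fin m) ℝ) (c : ℝ) (hc : c ≠ 0) (hP : ∀ k, (P k).det = c)
    (D : Fin L → Matrix (Fin m) (Fin m) ℝ) (hD : ∀ i, (D i).IsDiag)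
    (hlim : ∀ i, Tendsto (fun k => P k * A i * (P k).transpose) atTop (𝓝 (D i))) :
    IsTWSDB A := by
  -- A fixed diagonal scaling brings the determinant to 1; for `m = 0` the empty determinant already
  -- forces `c = 1`.
  obtain ⟨v, hv⟩ : ∃ v : Fin m → ℝ, (∏ j, v j) * c = 1 := by
    cases m with
    | zero => exact ⟨fun _ => 1, by simp [← hP 0]⟩
    | succ m => exact ⟨Fin.cons c⁻¹ fun _ => 1, by simp [Fin.prod_univ_succ, hc]⟩
  set E : Matrix (Fin m) (Fin m) ℝ := Matrix.diagonal v with hE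
  have key : ∀ i, Tendsto (fun k => (E * P k) * A i * (E * P k).transpose - E * D i * E)
      atTop (𝓝 0) := by
    intro i
    have h : Continuous fun X : Matrix (Fin m) (Fin m) ℝ => E * X * E - E * D i * E := by
      fun_prop
    have h2 := (h.tendsto (D i)).comp (hlim i)
    rw [sub_self] at h2
    refine h2.congr fun k => ?_
    simp [Function.comp, Matrix.transpose_mul, hE, Matrix.mul_assoc]
  refine ⟨fun k => ⟨E * P k, by rw [Matrix.det_mul, hP, hE, Matrix.det_diagonal, hv]⟩,
    fun _ i => E * D i * E, fun _ i => ?_, ?_, ∑ i, ‖E * D i * E‖, fun _ i => ?_⟩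
  · intro x y hxy
    simp [hE, Matrix.mul_diagonal, Matrix.diagonal_mul, hD i hxy]
  · unfold phiT
    rw [← Finset.sum_const_zero (ι := Fin L) (s := Finset.univ)]
    refine tendsto_finsetSum _ fun i _ => ?_
    simp only [frobenius_norm_sq]
    have h : Continuous fun X : Matrix (Fin m) (Fin m) ℝ => ∑ x, ∑ y, X x y ^ 2 := by
      fun_prop
    have h2 := (h.tendsto 0).comp (key i)
    simpa [Function.comp_def] using h2
  · exact Finset.single_le_sum (f := fun i => ‖E * D i * E‖) (fun _ _ => norm_nonneg _)
      (Finset.mem_univ i)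

end FrobeniusNorm

/-! ### Matrices intertwining a Jordan matrix with its transpose -/

/-- Each entry is determined by its upper and left neighbours, and the border is zero. Here `c` will
be a difference of eigenvalues. -/
lemma eq_zero_of_sylvester_recursion {n p : ℕ} {c : ℝ} (hc : c ≠ 0) (g : ℕ → ℕ → ℝ)
    (h0 : ∀ j, g 0 j = 0) (h0' : ∀ i, g i 0 = 0)
    (hg : ∀ i < n, ∀ j < p, c * g (i + 1) (j + 1) = g i (j + 1) - g (i + 1) j) :
    ∀ i ≤ n, ∀ j ≤ p, g i j = 0 := by
  intro i
  induction i with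
  | zero => intro _ j _; exact h0 j
  | succ i ihi =>
    intro hi j
    induction j with
    | zero => intro _; exact h0' _
    | succ j ihj =>
      intro hj
      have := hg i hi j hj
      rw [ihi (by omega) _ hj, ihj (by omega), sub_zero] at this
      exact (mul_eq_zero.mp this).resolve_left hc

lemma eq_of_hankel_recursion {n p : ℕ} (g : ℕ → ℕ → ℝ)
    (hg : ∀ i < n, ∀ j < p, g i (j + 1) = g (i + 1) j) (i₀ i : ℕ) :
    ∀ j, i₀ + i ≤ n → i + j ≤ p → g (i₀ + i) j = g i₀ (i + j) := by
  induction i with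
  | zero => intro j _ _; simp
  | succ i ih =>
    intro j hi hj
    rw [← add_assoc, ← hg (i₀ + i) (by omega) j (by omega), ih (j + 1) (by omega) (by omega)]
    congr 1; omega

/-- The entries are constant along antidiagonals. If `i + j ≤ p`, the antidiagonal can be followed
to row 0; if `i + j ≤ n`, to column 0. -/
lemma eq_zero_of_hankel_recursion {n p : ℕ} (g : ℕ → ℕ → ℝ)
    (h0 : ∀ j, g 0 j = 0) (h0' : ∀ i, g i 0 = 0)
    (hg : ∀ i < n, ∀ j < p, g i (j + 1) = g (i + 1) j)
    {i j : ℕ} (hi : i ≤ n) (hj : j ≤ p) (hij : i + j ≤ max n p) : g i j = 0 := by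
  rcases le_max_iff.mp hij with h | h
  · have := eq_of_hankel_recursion (n := p) (p := n) (fun a b => g b a)
      (fun a ha b hb => (hg b hb a ha).symm) 0 j i (by omega) (by omega)
    simpa [h0'] using this
  · have := eq_of_hankel_recursion g hg 0 i j (by omega) (by omega)
    simpa [h0] using this

/-- A matrix extended by zero, with rows and columns numbered from `1`. -/
def extendByZero {n p : ℕ} (H : Matrix (Fin n) (Fin p) ℝ) (i j : ℕ) : ℝ :=
  if h : (1 ≤ i ∧ i ≤ n) ∧ (1 ≤ j ∧ j ≤ p) then H ⟨i - 1, by omega⟩ ⟨j - 1, by omega⟩ else 0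

lemma extendByZero_succ {n p : ℕ} (H : Matrix (Fin n) (Fin p) ℝ) (i : Fin n) (j : Fin p) :
    extendByZero H (i + 1) (j + 1) = H i j := by
  have := i.2
  have := j.2
  rw [extendByZero, dif_pos (by omega)]
  rfl

lemma extendByZero_zero_left {n p : ℕ} (H : Matrix (Fin n) (Fin p) ℝ) (j : ℕ) :
    extendByZero H 0 j = 0 := by
  simp [extendByZero]

lemma extendByZero_zero_right {n p : ℕ} (H : Matrix (Fin n) (Fin p) ℝ) (i : ℕ) :
    extendByZero H i 0 = 0 := by
  simp [extendByZero]

lemma extendByZero_transpose {n p : ℕ} (H : Matrix (Fin n) (Fin p) ℝ) (i j : ℕ) :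
    extendByZero H.transpose j i = extendByZero H i j := by
  unfold extendByZero
  split_ifs <;> first | rfl | omega

-- The superdiagonal adds the column to the left. Numbered from 1, `extendByZero H (i + 1) j` is the
-- left neighbour of `H i j`, and is 0 in the first column.
open RealJordanBlock in
lemma mul_realJordan_apply {n p : ℕ} (H : Matrix (Fin n) (Fin p) ℝ) (μ : ℝ)
    (i : Fin n) (j : Fin p) :
    ∑ l, H i l * toMatrix (real μ p) l j = μ * H i j + extendByZero H (i + 1) j := by
  have hsplit : ∀ l : Fin p, H i l * toMatrix (real μ p) l j =
      (if l = j then μ * H i l else 0) + if l.val + 1 = j.val then H i l else 0 := by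
    intro l
    rcases eq_or_ne l j with rfl | h
    · simp [toMatrix, mul_comm]
    · simp [toMatrix, h]
  simp only [hsplit, Finset.sum_add_distrib]
  congr 1
  · simp
  · obtain ⟨_ | j, hj⟩ := j
    · simp [extendByZero_zero_right]
    · rw [Finset.sum_eq_single ⟨j, by omega⟩]
      · simpa using (extendByZero_succ H i ⟨j, by omega⟩).symm
      · intro b _ hb
        rw [if_neg]
        intro h
        exact hb (Fin.ext (by simpa using h))
      · simp

open RealJordanBlock in
/-- Entrywise form of `H * J_μ = J_λᵀ * H`. -/
lemma extendByZero_recursion {n p : ℕ} (H : Matrix (Fin n) (Fin p) ℝ) (lam μ : ℝ)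
    (h : ∀ i j, ∑ l, H i l * toMatrix (real μ p) l j = ∑ l, toMatrix (real lam n) l i * H l j) :
    ∀ i < n, ∀ j < p, (μ - lam) * extendByZero H (i + 1) (j + 1) =
      extendByZero H i (j + 1) - extendByZero H (i + 1) j := by
  intro i hi j hj
  have h1 := h ⟨i, hi⟩ ⟨j, hj⟩
  -- The row version is the column version for the transpose.
  have h2 := mul_realJordan_apply H.transpose lam ⟨j, hj⟩ ⟨i, hi⟩
  simp only [Matrix.transpose_apply, extendByZero_transpose] at h2
  rw [mul_realJordan_apply] at h1
  simp only [mul_comm (toMatrix (real lam n) _ _)] at h1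
  rw [h2] at h1
  have h3 := extendByZero_succ H ⟨i, hi⟩ ⟨j, hj⟩
  simp only at h1 h3
  rw [h3]
  linarith

/-! ### Shape of the intertwiners, and their degeneration under scaling. -/

section Sigma

open RealJordanBlock Matrix

variable {r : ℕ} (lam : Fin r → ℝ) (d : Fin r → ℕ)

/-- The block diagonal matrix with the real Jordan blocks of eigenvalues `lam` and sizes `d`. -/
def jordanMatrix : Matrix (Σ k, Fin (d k)) (Σ k, Fin (d k)) ℝ :=
  Matrix.blockDiagonal' fun k => toMatrix (real (lam k) (d k))

variable {lam d}

lemma block_intertwines {G : Matrix (Σ k, Fin (d k)) (Σ k, Fin (d k)) ℝ}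
    (hG : G * jordanMatrix lam d = (jordanMatrix lam d)ᵀ * G) (a b : Fin r)
    (i : Fin (d a)) (j : Fin (d b)) :
    ∑ l, G ⟨a, i⟩ ⟨b, l⟩ * toMatrix (real (lam b) (d b)) l j =
      ∑ l, toMatrix (real (lam a) (d a)) l i * G ⟨a, l⟩ ⟨b, j⟩ := by
  have h := congrFun (congrFun hG ⟨a, i⟩) ⟨b, j⟩
  simp only [Matrix.mul_apply, Matrix.transpose_apply, Fintype.sum_sigma] at h
  rw [Finset.sum_eq_single b, Finset.sum_eq_single a] at h
  · simpa [jordanMatrix, Matrix.blockDiagonal'_apply_eq] using h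
  · intro c _ hc
    exact Finset.sum_eq_zero fun l _ => by
      rw [jordanMatrix, Matrix.blockDiagonal'_apply_ne _ _ _ hc, zero_mul]
  · simp
  · intro c _ hc
    exact Finset.sum_eq_zero fun l _ => by
      rw [jordanMatrix, Matrix.blockDiagonal'_apply_ne _ _ _ hc, mul_zero]
  · simp

lemma entry_eq_zero {G : Matrix (Σ k, Fin (d k)) (Σ k, Fin (d k)) ℝ}
    (hG : G * jordanMatrix lam d = (jordanMatrix lam d)ᵀ * G) {a b : Fin r}
    (i : Fin (d a)) (j : Fin (d b))
    (h : lam a ≠ lam b ∨ i.val + j.val + 1 < max (d a) (d b)) : G ⟨a, i⟩ ⟨b, j⟩ = 0 := by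
  let H : Matrix (Fin (d a)) (Fin (d b)) ℝ := Matrix.of fun i j => G ⟨a, i⟩ ⟨b, j⟩
  have hrec := extendByZero_recursion H (lam a) (lam b) (block_intertwines hG a b)
  have hij : G ⟨a, i⟩ ⟨b, j⟩ = extendByZero H (i + 1) (j + 1) := (extendByZero_succ H i j).symm
  rw [hij]
  by_cases hl : lam a = lam b
  · refine eq_zero_of_hankel_recursion _ (extendByZero_zero_left H) (extendByZero_zero_right H)
      (fun x hx y hy => ?_) i.2 j.2 (by have := h.resolve_left (not_not.mpr hl); omega)
    have := hrec x hx y hy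
    rw [hl, sub_self, zero_mul] at this
    linarith
  · exact eq_zero_of_sylvester_recursion (sub_ne_zero.mpr (Ne.symm hl)) _
      (extendByZero_zero_left H) (extendByZero_zero_right H) hrec _ i.2 _ j.2

lemma entry_antidiagonal {G : Matrix (Σ k, Fin (d k)) (Σ k, Fin (d k)) ℝ}
    (hG : G * jordanMatrix lam d = (jordanMatrix lam d)ᵀ * G) (a : Fin r) :
    ∃ c : ℝ, ∀ i j : Fin (d a), i.val + j.val + 1 = d a → G ⟨a, i⟩ ⟨a, j⟩ = c := by
  let H : Matrix (Fin (d a)) (Fin (d a)) ℝ := Matrix.of fun i j => G ⟨a, i⟩ ⟨a, j⟩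
  have hrec := extendByZero_recursion H (lam a) (lam a) (block_intertwines hG a a)
  -- The constant is the top right corner of the block.
  refine ⟨extendByZero H 1 (d a), fun i j hij => ?_⟩
  have hG' : G ⟨a, i⟩ ⟨a, j⟩ = extendByZero H (i + 1) (j + 1) := (extendByZero_succ H i j).symm
  rw [hG']
  have := eq_of_hankel_recursion (extendByZero H) (n := d a) (p := d a)
    (fun x hx y hy => by
      have := hrec x hx y hy
      rw [sub_self, zero_mul] at this
      linarith) 1 i (j + 1) (by omega) (by omega)
  rw [add_comm (i : ℕ) 1, this]
  congr 1

/-- The exchange matrix, with ones on the antidiagonal. -/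
def exchangeMatrix (n : ℕ) : Matrix (Fin n) (Fin n) ℝ :=
  Matrix.of fun i j => if i.val + j.val + 1 = n then 1 else 0

/-- The weights `2 i + 1 - n` on a block of size `n`, which sum up to zero. -/
def weight (d : Fin r → ℕ) (x : Σ k, Fin (d k)) : ℤ := 2 * (x.2.val : ℤ) + 1 - d x.1

/-- Keeps the determinant of the scaling equal to 1: the first `n` odd numbers sum to `n * n`. -/
lemma prod_zpow_weight (d : Fin r → ℕ) {t : ℝ} (ht : t ≠ 0) :
    ∏ x : Σ k, Fin (d k), t ^ weight d x = 1 := by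
  rw [Fintype.prod_sigma]
  refine Finset.prod_eq_one fun a _ => ?_
  have hsum : ∀ n : ℕ, ∑ i ∈ Finset.range n, (2 * (i : ℤ) + 1) = n * n := by
    intro n
    induction n with
    | zero => simp
    | succ n ih => rw [Finset.sum_range_succ, ih]; push_cast; ring
  have hprod : ∀ s : Finset (Fin (d a)), ∏ i ∈ s, t ^ weight d ⟨a, i⟩ =
      t ^ ∑ i ∈ s, weight d ⟨a, i⟩ := by
    intro s
    induction s using Finset.induction_on with
    | empty => simp
    | insert i s hi ih => rw [Finset.prod_insert hi, Finset.sum_insert hi, ih, zpow_add₀ ht]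
  rw [hprod]
  simp only [weight, Finset.sum_sub_distrib]
  rw [Fin.sum_univ_eq_sum_range (fun i => 2 * (i : ℤ) + 1), hsum]
  simp

/-- Weighted scaling sends a matrix intertwining `J` and `Jᵀ`, where `J` has distinct Jordan
blocks, to a block diagonal matrix of multiples of exchange matrices. -/
lemma exists_tendsto_scaling (hdist : ∀ a b, lam a = lam b → d a = d b → a = b)
    {G : Matrix (Σ k, Fin (d k)) (Σ k, Fin (d k)) ℝ}
    (hG : G * jordanMatrix lam d = (jordanMatrix lam d)ᵀ * G) :
    ∃ c : Fin r → ℝ, Tendsto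
      (fun k : ℕ => diagonal (fun x => ((1 / 2 : ℝ) ^ k) ^ weight d x) * G *
        diagonal (fun x => ((1 / 2 : ℝ) ^ k) ^ weight d x)) atTop
      (𝓝 (blockDiagonal' fun a => c a • exchangeMatrix (d a))) := by
  choose c hc using entry_antidiagonal hG
  refine ⟨c, ?_⟩
  refine tendsto_pi_nhds.mpr fun x => tendsto_pi_nhds.mpr fun y => ?_
  obtain ⟨a, i⟩ := x
  obtain ⟨b, j⟩ := y
  have hzpow : ∀ k : ℕ, (diagonal (fun x => ((1 / 2 : ℝ) ^ k) ^ weight d x) * G *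
        diagonal (fun x => ((1 / 2 : ℝ) ^ k) ^ weight d x)) ⟨a, i⟩ ⟨b, j⟩ =
      ((1 / 2 : ℝ) ^ k) ^ (weight d ⟨a, i⟩ + weight d ⟨b, j⟩) * G ⟨a, i⟩ ⟨b, j⟩ := by
    intro k
    rw [mul_diagonal, diagonal_mul, zpow_add₀ (by positivity)]
    ring
  simp only [hzpow]
  by_cases hz : lam a ≠ lam b ∨ i.val + j.val + 1 < max (d a) (d b)
  · rw [entry_eq_zero hG i j hz]
    have hlim : blockDiagonal' (fun a => c a • exchangeMatrix (d a)) ⟨a, i⟩ ⟨b, j⟩ = 0 := by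
      by_cases hab : a = b
      · subst hab
        have : ¬ i.val + j.val + 1 = d a := by
          have := hz.resolve_left (not_not.mpr rfl)
          omega
        simp [blockDiagonal'_apply_eq, exchangeMatrix, this]
      · exact blockDiagonal'_apply_ne _ _ _ hab
    rw [hlim]
    simp
  · push Not at hz
    obtain ⟨hl, hz⟩ := hz
    by_cases hw : a = b ∧ i.val + j.val + 1 = d a
    · obtain ⟨rfl, hij⟩ := hw
      have h0 : weight d ⟨a, i⟩ + weight d ⟨a, j⟩ = 0 := by
        simp only [weight]; omega
      rw [h0, hc a i j hij]
      simp [blockDiagonal'_apply_eq, exchangeMatrix, hij]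
    · have hlim : blockDiagonal' (fun a => c a • exchangeMatrix (d a)) ⟨a, i⟩ ⟨b, j⟩ = 0 := by
        by_cases hab : a = b
        · subst hab
          have : ¬ i.val + j.val + 1 = d a := fun h => hw ⟨rfl, h⟩
          simp [blockDiagonal'_apply_eq, exchangeMatrix, this]
        · exact blockDiagonal'_apply_ne _ _ _ hab
      -- The exponent is `2 (i + j + 1) - d a - d b` with `i + j + 1 ≥ max (d a) (d b)`. It could
      -- vanish only for equal sizes; distinctness of the blocks then forces `a = b`, on the
      -- excluded antidiagonal.
      have hpos : 0 < weight d ⟨a, i⟩ + weight d ⟨b, j⟩ := by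
        simp only [weight]
        by_cases hab : a = b
        · subst hab
          have : ¬ i.val + j.val + 1 = d a := fun h => hw ⟨rfl, h⟩
          omega
        · have : d a ≠ d b := fun h => hab (hdist a b hl h)
          omega
      obtain ⟨n, hn⟩ := Int.eq_ofNat_of_zero_le hpos.le
      rw [hn] at hpos ⊢
      rw [hlim]
      have ht : Tendsto (fun k : ℕ => (1 / 2 : ℝ) ^ k) atTop (𝓝 0) :=
        tendsto_pow_atTop_nhds_zero_of_lt_one (by norm_num) (by norm_num)
      have := (ht.pow n).mul_const (G ⟨a, i⟩ ⟨b, j⟩)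
      rw [zero_pow (by omega), zero_mul] at this
      simpa only [zpow_natCast] using this

lemma exists_diagonalize_exchangeMatrix (n : ℕ) :
    ∃ (U : Matrix (Fin n) (Fin n) ℝ) (v : Fin n → ℝ), U.det ≠ 0 ∧
      U * exchangeMatrix n * Uᵀ = diagonal v := by
  have hF : (exchangeMatrix n).IsHermitian := by
    ext i j
    simp [exchangeMatrix, add_comm (i : ℕ)]
  refine ⟨(hF.eigenvectorUnitary : Matrix (Fin n) (Fin n) ℝ)ᵀ, hF.eigenvalues, ?_, ?_⟩
  · have h : (hF.eigenvectorUnitary : Matrix (Fin n) (Fin n) ℝ)ᵀ *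
        (hF.eigenvectorUnitary : Matrix (Fin n) (Fin n) ℝ) = 1 := by
      simpa [star_eq_conjTranspose] using Unitary.coe_star_mul_self hF.eigenvectorUnitary
    exact left_ne_zero_of_mul_eq_one (by rw [← det_mul, h, det_one])
  · have h : star (hF.eigenvectorUnitary : Matrix (Fin n) (Fin n) ℝ) * exchangeMatrix n *
        (hF.eigenvectorUnitary : Matrix (Fin n) (Fin n) ℝ) =
        diagonal (RCLike.ofReal ∘ hF.eigenvalues) := by
      simpa using hF.conjStarAlgAut_star_eigenvectorUnitary
    simpa [star_eq_conjTranspose, Function.comp_def] using h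

/-- `R` is independent of `c`, so it serves all members of the family at once. -/
lemma exists_diagonalize_blocks (d : Fin r → ℕ) :
    ∃ R : Matrix (Σ k, Fin (d k)) (Σ k, Fin (d k)) ℝ, R.det ≠ 0 ∧ ∀ c : Fin r → ℝ,
      (R * (blockDiagonal' fun a => c a • exchangeMatrix (d a)) * Rᵀ).IsDiag := by
  choose U v hdet hU using fun a => exists_diagonalize_exchangeMatrix (d a)
  refine ⟨blockDiagonal' U, ?_, fun c => ?_⟩
  · refine left_ne_zero_of_mul_eq_one (b := (blockDiagonal' fun a => (U a)⁻¹).det) ?_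
    rw [← det_mul, ← blockDiagonal'_mul]
    simp only [fun a => mul_nonsing_inv (U a) (hdet a).isUnit]
    exact (congrArg det (blockDiagonal'_one)).trans det_one
  · rw [blockDiagonal'_transpose, ← blockDiagonal'_mul, ← blockDiagonal'_mul]
    have : (fun a => U a * (c a • exchangeMatrix (d a)) * (U a)ᵀ) =
        fun a => diagonal fun i => c a * v a i := by
      funext a
      rw [mul_smul_comm, smul_mul_assoc, hU, ← diagonal_smul]
      rfl
    rw [this, blockDiagonal'_diagonal]
    exact isDiag_diagonal _

/-- A family whose members all intertwine `J` and `Jᵀ` in suitable coordinates, for a real Jordan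
matrix `J` with distinct blocks, is TWSD-B. -/
lemma isTWSDB_of_intertwines {m L : ℕ} (A : Fin L → Matrix (Fin m) (Fin m) ℝ)
    (hdist : ∀ a b, lam a = lam b → d a = d b → a = b)
    (e : (Σ k, Fin (d k)) ≃ Fin m) (Q : Matrix (Fin m) (Fin m) ℝ) (hQ : IsUnit Q.det)
    (h : ∀ i, (Qᵀ * A i * Q) * reindex e e (jordanMatrix lam d) =
      (reindex e e (jordanMatrix lam d))ᵀ * (Qᵀ * A i * Q)) :
    IsTWSDB A := by
  obtain ⟨R, hR, hRd⟩ := exists_diagonalize_blocks d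
  have hG : ∀ i, (Qᵀ * A i * Q).submatrix e e * jordanMatrix lam d =
      (jordanMatrix lam d)ᵀ * (Qᵀ * A i * Q).submatrix e e := by
    intro i
    have hsub : jordanMatrix lam d = (reindex e e (jordanMatrix lam d)).submatrix e e := by
      simp
    rw [hsub, transpose_submatrix, submatrix_mul_equiv, submatrix_mul_equiv, h i]
  choose c hc using fun i => exists_tendsto_scaling hdist (hG i)
  let T : ℕ → Matrix (Σ k, Fin (d k)) (Σ k, Fin (d k)) ℝ := fun k =>
    diagonal fun x => ((1 / 2 : ℝ) ^ k) ^ weight d x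
  have hT : ∀ k, (T k).det = 1 := fun k => by
    simp only [T, det_diagonal]
    exact prod_zpow_weight d (by positivity)
  refine isTWSDB_of_tendsto A (fun k => reindex e e (R * T k) * Qᵀ) (R.det * Q.det)
    (mul_ne_zero hR hQ.ne_zero) (fun k => ?_)
    (fun i => reindex e e (R * (blockDiagonal' fun a => c i a • exchangeMatrix (d a)) * Rᵀ))
    (fun i => (hRd (c i)).submatrix e.symm.injective) (fun i => ?_)
  · rw [det_mul, det_reindex_self, det_mul, hT, det_transpose, mul_one]
  · have hcont : Continuous fun X : Matrix (Σ k, Fin (d k)) (Σ k, Fin (d k)) ℝ =>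
        reindex e e (R * X * Rᵀ) := by
      simp only [reindex_apply]
      fun_prop
    refine ((hcont.tendsto _).comp (hc i)).congr fun k => ?_
    have hTt : (T k)ᵀ = T k := diagonal_transpose _
    have hsub : Qᵀ * A i * Q = ((Qᵀ * A i * Q).submatrix e e).submatrix e.symm e.symm := by
      simp [submatrix_submatrix]
    calc reindex e e (R * (T k * (Qᵀ * A i * Q).submatrix e e * T k) * Rᵀ)
        = reindex e e (R * T k) * (Qᵀ * A i * Q) * (reindex e e (R * T k))ᵀ := by
          conv_rhs => rw [hsub]
          simp only [reindex_apply, transpose_submatrix, submatrix_mul_equiv, transpose_mul, hTt,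
            Matrix.mul_assoc]
      _ = reindex e e (R * T k) * Qᵀ * A i * (reindex e e (R * T k) * Qᵀ)ᵀ := by
          simp only [transpose_mul, transpose_transpose, Matrix.mul_assoc]

end Sigma

/-! ### Exclusion of non-real Jordan blocks. -/

instance RealJordanBlock.fintypeIndex : (X : RealJordanBlock) → Fintype X.Index
  | real _ d => inferInstanceAs (Fintype (Fin d))
  | cplx _ _ d => inferInstanceAs (Fintype (Fin d × Fin 2))

open Matrix RealJordanBlock in
/-- A non-real Jordan block has a complex eigenvector for a non-real eigenvalue. -/
lemma RealJordanBlock.eq_real_or_exists_eigenvector (X : RealJordanBlock) (hX : X.Valid) :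
    (∃ lam d, X = real lam d) ∨ ∃ (z : ℂ) (u : X.Index → ℂ),
      z.im ≠ 0 ∧ u ≠ 0 ∧ X.toMatrix.map (algebraMap ℝ ℂ) *ᵥ u = z • u := by
  rcases X with ⟨lam, d⟩ | ⟨a, b, d⟩
  · exact Or.inl ⟨lam, d, rfl⟩
  obtain ⟨hb, hd⟩ := hX
  obtain ⟨d, rfl⟩ := Nat.exists_eq_succ_of_ne_zero (Nat.one_le_iff_ne_zero.mp hd)
  -- `(1, -i)` is an eigenvector of `[a, -b; b, a]` for `a + b i`; the first cell spans an invariant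
  -- subspace because the block is block upper triangular.
  let u : Fin (d + 1) × Fin 2 → ℂ := fun x => if x.1 = 0 then ![1, -Complex.I] x.2 else 0
  refine Or.inr ⟨⟨a, b⟩, u, hb.ne', ?_, ?_⟩
  · intro h
    simpa [u] using congrFun h (0, 0)
  · funext x
    obtain ⟨i, j⟩ := x
    have hsum : ∀ f : Fin (d + 1) × Fin 2 → ℂ,
        ∑ x, f x * u x = f (0, 0) - f (0, 1) * Complex.I := by
      intro f
      rw [Fintype.sum_prod_type, Finset.sum_eq_single 0]
      · simp [u, sub_eq_add_neg]
      · intro y _ hy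
        simp [u, hy]
      · simp
    refine (hsum fun y => (toMatrix (cplx a b (d + 1)) (i, j) y : ℂ)).trans ?_
    by_cases hi : i = 0
    · subst hi
      fin_cases j <;> simp [u, toMatrix, Complex.ext_iff]
    · simp [u, hi, toMatrix]

open Matrix in
lemma blockDiagonal'_mulVec_single {ι : Type*} [DecidableEq ι] [Fintype ι] {n : ι → Type*}
    [∀ k, Fintype (n k)] (N : ∀ k, Matrix (n k) (n k) ℂ) (k : ι) (u : n k → ℂ) (z : ℂ)
    (h : N k *ᵥ u = z • u) :
    blockDiagonal' N *ᵥ (fun x : Σ k, n k => (Pi.single k u : ∀ l, n l → ℂ) x.1 x.2) =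
      z • fun x : Σ k, n k => (Pi.single k u : ∀ l, n l → ℂ) x.1 x.2 := by
  funext ⟨l, x⟩
  simp only [mulVec, dotProduct, Fintype.sum_sigma, Pi.smul_apply]
  rw [Finset.sum_eq_single k]
  · by_cases hl : l = k
    · subst hl
      simpa [blockDiagonal'_apply_eq, mulVec, dotProduct] using congrFun h x
    · simp [blockDiagonal'_apply_ne _ _ _ hl, Pi.single_eq_of_ne hl]
  · intro c _ hc
    simp [Pi.single_eq_of_ne hc]
  · simp

open Matrix in
/-- A matrix with only real eigenvalues has no non-real blocks in its real Jordan form. -/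
lemma exists_eq_real_of_hasOnlyRealEigenvalues {m r : ℕ} {M : Matrix (Fin m) (Fin m) ℝ}
    {B : Fin r → RealJordanBlock} (hM : HasOnlyRealEigenvalues M)
    (hB : IsRealJordanNormalForm M B) (k : Fin r) :
    ∃ lam d, B k = RealJordanBlock.real lam d := by
  obtain ⟨hvalid, e, Q, hQ, hJ⟩ := hB
  refine ((B k).eq_real_or_exists_eigenvector (hvalid k)).resolve_right ?_
  rintro ⟨z, u, hz, hu, hzu⟩
  have hw := blockDiagonal'_mulVec_single (fun l => (B l).toMatrix.map (algebraMap ℝ ℂ)) k u z hzu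
  set w : (Σ l, (B l).Index) → ℂ := fun x => (Pi.single k u : ∀ l, (B l).Index → ℂ) x.1 x.2
    with hw_def
  have hw0 : w ≠ 0 := by
    intro h
    refine hu (funext fun x => ?_)
    simpa [hw_def] using congrFun h ⟨k, x⟩
  set Qc : Matrix (Fin m) (Fin m) ℂ := Q.map (algebraMap ℝ ℂ) with hQc
  have hQu : IsUnit Qc := by
    rw [isUnit_iff_isUnit_det, hQc, ← RingHom.mapMatrix_apply, ← RingHom.map_det]
    exact hQ.map _
  have hMQ : M * Q = Q * reindex e e (blockDiagonal' fun l => (B l).toMatrix) := by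
    rw [← hJ, Matrix.mul_assoc, mul_nonsing_inv_cancel_left _ _ hQ]
  have hMQc : M.map (algebraMap ℝ ℂ) * Qc = Qc *
      (blockDiagonal' fun l => (B l).toMatrix.map (algebraMap ℝ ℂ)).submatrix e.symm e.symm := by
    have h := congrArg (fun X => X.map (algebraMap ℝ ℂ)) hMQ
    simp only [Matrix.map_mul, reindex_apply] at h
    rw [h, ← blockDiagonal'_map _ _ (map_zero _)]
    rfl
  refine hz (hM z (Module.End.hasEigenvalue_of_hasEigenvector
    (x := Qc *ᵥ (w ∘ e.symm)) ⟨Module.End.mem_eigenspace_iff.mpr ?_, ?_⟩))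
  · rw [toLin'_apply, mulVec_mulVec, hMQc, ← mulVec_mulVec, submatrix_mulVec_equiv,
      ← mulVec_smul]
    congr 1
    have : (w ∘ e.symm) ∘ e.symm.symm = w := by
      funext x
      simp
    rw [this, hw]
    rfl
  · intro h
    have h0 := mulVec_injective_of_isUnit hQu (h.trans (mulVec_zero Qc).symm)
    refine hw0 (funext fun x => ?_)
    simpa using congrFun h0 (e x)

/-! ### Passage from commutation to intertwining. -/

theorem mainTheorem7 {m L : ℕ} (A : Fin L → Matrix (Fin m) (Fin m) ℝ)
    (hA : ∀ i, (A i).IsSymm)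
    (S : Matrix (Fin m) (Fin m) ℝ)
    (hS : S ∈ Submodule.span ℝ (Set.range A))
    (hdet : IsUnit S.det)
    (hreal : ∀ i, HasOnlyRealEigenvalues (S⁻¹ * A i))
    (hcomm : ∀ i j, i ≠ j → sCommutator S (A i) (A j) = 0)
    (hblocks : ∃ i, HasDistinctJordanBlocks (S⁻¹ * A i)) :
    IsTWSDB A := by
  obtain ⟨i₀, r, B, hJ, hdist⟩ := hblocks
  choose lam d hB using exists_eq_real_of_hasOnlyRealEigenvalues (hreal i₀) hJ
  obtain rfl : B = fun k => RealJordanBlock.real (lam k) (d k) := funext hB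
  obtain ⟨-, e, Q, hQ, hJ⟩ := hJ
  have hSsymm : S.IsSymm := by
    refine Submodule.span_induction (p := fun X _ => X.IsSymm) ?_ Matrix.isSymm_zero
      (fun _ _ _ _ => Matrix.IsSymm.add) (fun c _ _ hX => hX.smul c) hS
    rintro _ ⟨i, rfl⟩
    exact hA i
  have hswap : ∀ i, A i * (S⁻¹ * A i₀) = (S⁻¹ * A i₀).transpose * A i := by
    intro i
    rw [Matrix.transpose_mul, Matrix.transpose_nonsing_inv, hSsymm.eq, (hA i₀).eq]
    rcases eq_or_ne i i₀ with rfl | hne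
    · rw [Matrix.mul_assoc]
    -- Cancelling the leading `S⁻¹` leaves `A i S⁻¹ A i₀ = A i₀ S⁻¹ A i`, whose right side starts
    -- with `(S⁻¹ A i₀)ᵀ` by symmetry.
    · have h := congrArg (S * ·) (sub_eq_zero.mp (hcomm i i₀ hne))
      simpa [Matrix.mul_assoc, Matrix.mul_nonsing_inv_cancel_left S _ hdet] using h
  refine isTWSDB_of_intertwines (lam := lam) (d := d) A (fun a b h1 h2 => ?_) e Q hQ fun i => ?_
  · by_contra hab
    exact hdist a b hab (by simp only [h1, h2])
  · change _ * Matrix.reindex e e (Matrix.blockDiagonal' _) =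
      (Matrix.reindex e e (Matrix.blockDiagonal' _)).transpose * _
    rw [← hJ, Matrix.transpose_mul, Matrix.transpose_mul, Matrix.transpose_nonsing_inv]
    have hQt : IsUnit Q.transpose.det := by rwa [Matrix.det_transpose]
    calc Q.transpose * A i * Q * (Q⁻¹ * (S⁻¹ * A i₀) * Q)
        = Q.transpose * (A i * (S⁻¹ * A i₀)) * Q := by
          simp only [Matrix.mul_assoc, Matrix.mul_nonsing_inv_cancel_left Q _ hQ]
      _ = Q.transpose * ((S⁻¹ * A i₀).transpose * (Q.transpose⁻¹)) *
            (Q.transpose * A i * Q) := by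
          rw [hswap]
          simp only [Matrix.mul_assoc, Matrix.nonsing_inv_mul_cancel_left Q.transpose _ hQt]

end
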